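/- Proposition 1. Work in bipartite EPR scenarios with a finite-dimensional system for Bob. An assemblage $\boldsymbol\Sigma=\{\{\sigma_{a|x}\}_{a}\}_{x}$ (finite sets of outcomes $a$ and of settings $x$, with at least one setting) is a family of operators of the form $\sigma_{a|x}=\mathrm{tr}_A[(M_{a|x}\otimes\mathbb I)\rho]$, with $\rho$ a density operator on $\mathcal H_A\otimes\mathcal H_B$ and $\{M_{a|x}\}_a$ a POVM on $\mathcal H_A$ for each $x$. In both classes of operations below, Alice's local classical processing is a conditional distribution $p(a',x|x',a,\cdot)$ whose marginal on $x$ does not depend on $a$. * $\boldsymbol\Sigma$ is convertible to $\boldsymbol\Sigma'$ under LOSR if $\sigma'_{a'|x'}=\sum_\lambda p(\lambda)\sum_{a,x}p(a',x|x',a,\lambda)\,\mathcal E_\lambda(\sigma_{a|x})$ for a finitely valued shared random variable $\lambda$ with distribution $p(\lambda)$, local processings $p(a',x|x',a,\lambda)$ of Alice, and CPTP maps $\mathcal E_\lambda$ of Bob. * $\boldsymbol\Sigma$ is convertible to $\boldsymbol\Sigma'$ under S-1W-LOCC with success probability $P>0$ if $P\,\sigma'_{a'|x'}=\sum_\omega\sum_{a,x}p(a',x|x',a,\omega)\,\mathcal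 E_\omega(\sigma_{a|x})$ for finitely many completely positive maps $\mathcal E_\omega$ of Bob whose sum is trace non-increasing, and local processings $p(a',x|x',a,\omega)$ of Alice. It is convertible under deterministic 1W-LOCC if one can take $\sum_\omega\mathcal E_\omega$ trace preserving and $P=1$. Each of these three convertibility relations is a pre-order on assemblages. For $\theta\in(0,\pi/4]$ and $p\in[0,1]$ let $\boldsymbol\Sigma^{\theta,p}$ be the assemblage with elements $p\,\sigma^\theta_{a|x}+(1-p)\,\mathbb I/4$, $a,x\in\{0,1\}$, where $\sigma^\theta_{a|x}=\mathrm{tr}_A[(\widetilde M_{a|x}\otimes\mathbb I)|\theta\rangle\langle\theta|]$, $|\theta\rangle=\cos\theta|00\rangle+\sin\theta|11\rangle$, $\widetilde M_{a|0}=(\mathbb I+(-1)^a\sigma_z)/2$, $\widetilde M_{a|1}=(\mathbb I+(-1)^a\sigma_x)/2$. Then: 1. The pre-order of assemblages under LOSR is different from the pre-order under S-1W-LOCC, and also from the pre-order under deterministic 1W-LOCC. 2. For every $\theta\in(0,\pi/4]$, the S-1W-LOCC operation whose instrument has the single map $M_0\cdot M_0^\dagger$, $M_0=\cos\theta|0\rangle\langle0|+\sin\theta|1\rangle\langle1|$,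 with no action by Alice, converts $\boldsymbol\Sigma^{\pi/4,1}$ to $\boldsymbol\Sigma^{\theta,1}$ with success probability $1/2$. 3. For every $\theta\in(0,\pi/4]$, the 1W-LOCC operation with the instrument $\{M_\omega\cdot M_\omega^\dagger\}_{\omega\in\{0,1\}}$, $M_1=\sin\theta|1\rangle\langle0|+\cos\theta|0\rangle\langle1|$, in which Alice measures $x=x'$ and outputs $a'=a\oplus x\omega\oplus\omega$, is deterministic and converts $\boldsymbol\Sigma^{\pi/4,1}$ to $\boldsymbol\Sigma^{\theta,1}$. 4. Under S-1W-LOCC, and also under deterministic 1W-LOCC, $\boldsymbol\Sigma^{\pi/4,1}$ is convertible to $\boldsymbol\Sigma^{\theta,p}$ for all $\theta\in(0,\pi/4]$ and $p\in[0,1]$. 5. Under LOSR, the assemblages $\boldsymbol\Sigma^{\theta,1}$, $\theta\in(0,\pi/4]$, are pairwise incomparable: if $\theta_1\ne\theta_2$, neither of $\boldsymbol\Sigma^{\theta_1,1}$, $\boldsymbol\Sigma^{\theta_2,1}$ is convertible to the other. -/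

import Mathlib

open scoped Matrix Kronecker ComplexOrder
open Matrix Real

/-- Complex square matrices: the operators on a `d`-dimensional quantum system. -/
abbrev Op (d : ℕ) : Type := Matrix (Fin d) (Fin d) ℂ

/-! ### Quantum channels on finite-dimensional systems -/

/-- Complete positivity: for every `k`, the map `Φ ⊗ id_k` sends positive semidefinite matrices
to positive semidefinite matrices. -/
def IsCompletelyPositive {d e : ℕ} (Φ : Op d →ₗ[ℂ] Op e) : Prop :=
  ∀ (k : ℕ) (M : Matrix (Fin d × Fin k) (Fin d × Fin k) ℂ), M.PosSemidef →
    (Matrix.of fun r s : Fin e × Fin k =>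
      Φ (Matrix.of fun i j => M (i, r.2) (j, s.2)) r.1 s.1).PosSemidef

/-- Trace preservation. -/
def IsTracePreserving {d e : ℕ} (Φ : Op d →ₗ[ℂ] Op e) : Prop :=
  ∀ ρ : Op d, (Φ ρ).trace = ρ.trace

/-- The map `ρ ↦ K ρ K†` with a single Kraus operator `K`. -/
def krausMap {d e : ℕ} (K : Matrix (Fin e) (Fin d) ℂ) : Op d →ₗ[ℂ] Op e where
  toFun ρ := K * ρ * Kᴴ
  map_add' ρ τ := by rw [Matrix.mul_add, Matrix.add_mul]
  map_smul' c ρ := by simp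

theorem isCompletelyPositive_id (d : ℕ) :
    IsCompletelyPositive (LinearMap.id : Op d →ₗ[ℂ] Op d) := fun _ _ hM => hM

theorem IsCompletelyPositive.comp {d e f : ℕ} {Ψ : Op e →ₗ[ℂ] Op f} {Φ : Op d →ₗ[ℂ] Op e}
    (hΨ : IsCompletelyPositive Ψ) (hΦ : IsCompletelyPositive Φ) :
    IsCompletelyPositive (Ψ ∘ₗ Φ) := fun k _ hM => hΨ k _ (hΦ k _ hM)

theorem IsCompletelyPositive.posSemidef {d e : ℕ} {Φ : Op d →ₗ[ℂ] Op e}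
    (hΦ : IsCompletelyPositive Φ) {ρ : Op d} (hρ : ρ.PosSemidef) : (Φ ρ).PosSemidef := by
  have h := hΦ 1 (ρ.submatrix Prod.fst Prod.fst) (hρ.submatrix Prod.fst)
  exact h.submatrix (fun i : Fin e => (i, (0 : Fin 1)))

theorem isCompletelyPositive_krausMap {d e : ℕ} (K : Matrix (Fin e) (Fin d) ℂ) :
    IsCompletelyPositive (krausMap K) := by
  intro k M hM
  have h := hM.mul_mul_conjTranspose_same (K ⊗ₖ (1 : Matrix (Fin k) (Fin k) ℂ))
  convert h using 1
  ext ⟨i, r⟩ ⟨j, s⟩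
  simp [krausMap, Matrix.mul_apply, Fintype.sum_prod_type, Matrix.one_apply,
    Matrix.conjTranspose_apply, apply_ite]

/-! ### Assemblages -/

/-- Partial trace over the first (Alice's) tensor factor. -/
def ptraceA {m d : ℕ} (ρ : Matrix (Fin m × Fin d) (Fin m × Fin d) ℂ) : Op d :=
  Matrix.of fun i j => ∑ k, ρ (k, i) (k, j)

/-- `σ_{a|x} = tr_A[(M_{a|x} ⊗ 1) ρ]` for a state `ρ` shared by Alice and Bob and POVMs
`{M_{a|x}}_a` on Alice's system. -/
def IsQuantumRealization {nA nX m d : ℕ}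
    (ρ : Matrix (Fin m × Fin d) (Fin m × Fin d) ℂ) (M : Fin nA → Fin nX → Op m)
    (σ : Fin nA → Fin nX → Op d) : Prop :=
  ρ.PosSemidef ∧ ρ.trace = 1 ∧
  (∀ a x, (M a x).PosSemidef) ∧ (∀ x, ∑ a, M a x = 1) ∧
  ∀ a x, σ a x = ptraceA ((M a x ⊗ₖ (1 : Op d)) * ρ)

/-- A (quantumly realizable) bipartite assemblage with `nX` measurement settings and `nA`
outcomes for Alice, and a `d`-dimensional quantum system for Bob. `σ a x` is the unnormalised
state `σ_{a|x} = p(a|x) ρ_{a|x}`. -/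
structure Assemblage (nA nX d : ℕ) where
  σ : Fin nA → Fin nX → Op d
  realizable : ∃ (m : ℕ) (ρ : Matrix (Fin m × Fin d) (Fin m × Fin d) ℂ)
    (M : Fin nA → Fin nX → Op m), IsQuantumRealization ρ M σ

/-- The resources: assemblages with any numbers of settings and outcomes and any dimension of
Bob's system. -/
structure Resource where
  nA : ℕ
  nX : ℕ
  d : ℕ
  nX_pos : 0 < nX
  asm : Assemblage nA nX d

/-! ### Local processing -/

/-- Alice's local classical processing `p(a', x | x', a)`: she chooses the input `x` knowing
`x'`, then the output `a'` knowing `x'`, `x` and `a`. The marginal distribution `inp x x'` of `x`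
depends on `x'` only and not on the later variable `a` (no retrocausation); equivalently,
`p(a', x | x', a) = p(x | x') p(a' | a, x, x')`. -/
structure Comb (nA nX nA' nX' : ℕ) where
  prob : Fin nA' → Fin nX → Fin nX' → Fin nA → ℝ
  inp : Fin nX → Fin nX' → ℝ
  nonneg : ∀ a' x x' a, 0 ≤ prob a' x x' a
  inp_nonneg : ∀ x x', 0 ≤ inp x x'
  sum_inp : ∀ x', ∑ x, inp x x' = 1
  no_retro : ∀ x x' a, ∑ a', prob a' x x' a = inp x x'

/-- The deterministic processing `x = g x'`, `a' = f a x'`. -/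
def Comb.ofFun {nA nX nA' nX' : ℕ} (g : Fin nX' → Fin nX) (f : Fin nA → Fin nX' → Fin nA') :
    Comb nA nX nA' nX' where
  prob a' x x' a := if a' = f a x' then (if x = g x' then 1 else 0) else 0
  inp x x' := if x = g x' then 1 else 0
  nonneg a' x x' a := by split_ifs <;> norm_num
  inp_nonneg x x' := by split_ifs <;> norm_num
  sum_inp x' := by simp
  no_retro x x' a := by simp

/-- Sequential composition: `C` is applied first, `D` to its result. -/
def Comb.comp {nA nX nA' nX' nA'' nX'' : ℕ} (D : Comb nA' nX' nA'' nX'')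
    (C : Comb nA nX nA' nX') : Comb nA nX nA'' nX'' where
  prob a'' x x'' a := ∑ a', ∑ x', D.prob a'' x' x'' a' * C.prob a' x x' a
  inp x x'' := ∑ x', D.inp x' x'' * C.inp x x'
  nonneg a'' x x'' a := Finset.sum_nonneg fun a' _ => Finset.sum_nonneg fun x' _ =>
    mul_nonneg (D.nonneg ..) (C.nonneg ..)
  inp_nonneg x x'' := Finset.sum_nonneg fun x' _ => mul_nonneg (D.inp_nonneg ..) (C.inp_nonneg ..)
  sum_inp x'' := by
    rw [Finset.sum_comm]
    simp_rw [← Finset.mul_sum, C.sum_inp, mul_one, D.sum_inp]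
  no_retro x x'' a := by
    rw [Finset.sum_comm]
    simp_rw [Finset.sum_comm (s := (Finset.univ : Finset (Fin nA''))), ← Finset.sum_mul,
      D.no_retro]
    rw [Finset.sum_comm]
    simp_rw [← Finset.mul_sum, C.no_retro]

/-- One branch of a transformation: Alice processes her classical variables with `C`, and Bob
applies `Φ`. The result is
`σ'_{a'|x'} = ∑_{a,x} p(a', x | x', a) Φ(σ_{a|x})`. -/
def branch {nA nX d nA' nX' d' : ℕ} (C : Comb nA nX nA' nX') (Φ : Op d →ₗ[ℂ] Op d')
    (σ : Fin nA → Fin nX → Op d) (a' : Fin nA') (x' : Fin nX') : Op d' :=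
  ∑ a, ∑ x, ((C.prob a' x x' a : ℝ) : ℂ) • Φ (σ a x)

theorem branch_id {nA nX d : ℕ} (σ : Fin nA → Fin nX → Op d) (a : Fin nA) (x : Fin nX) :
    branch (Comb.ofFun id fun a _ => a) LinearMap.id σ a x = σ a x := by
  simp only [branch, Comb.ofFun, LinearMap.id_coe, id]
  rw [Finset.sum_eq_single a (by intro b _ hb; simp [Ne.symm hb]) (by simp),
    Finset.sum_eq_single x (by intro b _ hb; simp [hb]) (by simp)]
  simp

theorem branch_comp {nA nX d nA' nX' d' nA'' nX'' d'' : ℕ}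
    (D : Comb nA' nX' nA'' nX'') (C : Comb nA nX nA' nX')
    (Ψ : Op d' →ₗ[ℂ] Op d'') (Φ : Op d →ₗ[ℂ] Op d') (σ : Fin nA → Fin nX → Op d)
    (a'' : Fin nA'') (x'' : Fin nX'') :
    branch D Ψ (branch C Φ σ) a'' x'' = branch (D.comp C) (Ψ ∘ₗ Φ) σ a'' x'' := by
  simp only [branch, Comb.comp, map_sum, map_smul, LinearMap.comp_apply, Finset.smul_sum,
    smul_smul, Complex.ofReal_sum, Complex.ofReal_mul, Finset.sum_smul]
  calc _ = ∑ a', ∑ a, ∑ x', ∑ x, _ := Finset.sum_congr rfl fun a' _ => Finset.sum_comm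
    _ = ∑ a, ∑ a', ∑ x', ∑ x, _ := Finset.sum_comm
    _ = ∑ a, ∑ a', ∑ x, ∑ x', _ :=
      Finset.sum_congr rfl fun a _ => Finset.sum_congr rfl fun a' _ => Finset.sum_comm
    _ = _ := Finset.sum_congr rfl fun a _ => Finset.sum_comm

theorem branch_sum_smul {nA nX d nA' nX' d' : ℕ} {ι : Type} [Fintype ι]
    (C : Comb nA nX nA' nX') (Φ : Op d →ₗ[ℂ] Op d') (c : ι → ℂ)
    (σ : ι → Fin nA → Fin nX → Op d) (a' : Fin nA') (x' : Fin nX') :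
    branch C Φ (fun a x => ∑ i, c i • σ i a x) a' x' = ∑ i, c i • branch C Φ (σ i) a' x' := by
  simp only [branch, map_sum, map_smul, Finset.smul_sum]
  calc _ = ∑ a, ∑ i, ∑ x, _ := Finset.sum_congr rfl fun a _ => Finset.sum_comm
    _ = ∑ i, ∑ a, ∑ x, _ := Finset.sum_comm
    _ = _ := Finset.sum_congr rfl fun i _ => Finset.sum_congr rfl fun a _ =>
      Finset.sum_congr rfl fun x _ => smul_comm _ _ _

/-! ### LOSR operations -/

/-- An LOSR operation: a shared classical random variable `l` with distribution `p`; given `l`,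
Alice applies the classical processing `alice l` and Bob the CPTP map `bob l`. -/
structure LOSROp (nA nX d nA' nX' d' : ℕ) where
  L : Type
  [fintypeL : Fintype L]
  p : L → ℝ
  p_nonneg : ∀ l, 0 ≤ p l
  sum_p : ∑ l, p l = 1
  alice : L → Comb nA nX nA' nX'
  bob : L → (Op d →ₗ[ℂ] Op d')
  bob_cp : ∀ l, IsCompletelyPositive (bob l)
  bob_tp : ∀ l, IsTracePreserving (bob l)

attribute [instance] LOSROp.fintypeL

/-- The action of an LOSR operation,
`σ'_{a'|x'} = ∑_l p(l) ∑_{a,x} p(a', x | x', a, l) bob_l(σ_{a|x})`. -/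
def LOSROp.apply {nA nX d nA' nX' d' : ℕ} (T : LOSROp nA nX d nA' nX' d')
    (σ : Fin nA → Fin nX → Op d) (a' : Fin nA') (x' : Fin nX') : Op d' :=
  ∑ l, ((T.p l : ℝ) : ℂ) • branch (T.alice l) (T.bob l) σ a' x'

/-- `R` can be converted into `S` by an LOSR operation. -/
def LOSRConvertible (R S : Resource) : Prop :=
  ∃ T : LOSROp R.nA R.nX R.d S.nA S.nX S.d, ∀ a' x', T.apply R.asm.σ a' x' = S.asm.σ a' x'

theorem LOSRConvertible.refl (R : Resource) : LOSRConvertible R R :=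
  ⟨{ L := Unit
     p := fun _ => 1
     p_nonneg := fun _ => zero_le_one
     sum_p := by simp
     alice := fun _ => Comb.ofFun id fun a _ => a
     bob := fun _ => LinearMap.id
     bob_cp := fun _ => isCompletelyPositive_id _
     bob_tp := fun _ _ => rfl }, fun a x => by simp [LOSROp.apply, branch_id]⟩

theorem LOSRConvertible.trans {R S T : Resource} (h₁ : LOSRConvertible R S)
    (h₂ : LOSRConvertible S T) : LOSRConvertible R T := by
  obtain ⟨U, hU⟩ := h₁
  obtain ⟨V, hV⟩ := h₂
  refine ⟨{ L := V.L × U.L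
            p := fun l => V.p l.1 * U.p l.2
            p_nonneg := fun l => mul_nonneg (V.p_nonneg _) (U.p_nonneg _)
            sum_p := by
              rw [Fintype.sum_prod_type]
              simp_rw [← Finset.mul_sum, U.sum_p, mul_one, V.sum_p]
            alice := fun l => (V.alice l.1).comp (U.alice l.2)
            bob := fun l => V.bob l.1 ∘ₗ U.bob l.2
            bob_cp := fun l => (V.bob_cp _).comp (U.bob_cp _)
            bob_tp := fun l ρ => (V.bob_tp _ _).trans (U.bob_tp _ _) }, fun a'' x'' => ?_⟩
  have hS : S.asm.σ = fun a x => ∑ l, ((U.p l : ℝ) : ℂ) •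
      branch (U.alice l) (U.bob l) R.asm.σ a x := by
    funext a x
    exact (hU a x).symm
  rw [← hV a'' x'']
  simp only [LOSROp.apply]
  rw [hS, Fintype.sum_prod_type]
  refine Finset.sum_congr rfl fun l _ => ?_
  rw [branch_sum_smul, Finset.smul_sum]
  refine Finset.sum_congr rfl fun m _ => ?_
  rw [branch_comp, smul_smul, Complex.ofReal_mul]

/-- The pre-order of assemblages under LOSR: `R ≤ S` if `S` can be converted into `R`. -/
abbrev losrPreorder : Preorder Resource where
  le R S := LOSRConvertible S R
  le_refl := LOSRConvertible.refl
  le_trans _ _ _ h₁ h₂ := h₂.trans h₁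

/-! ### Stochastic local operations assisted by one-way classical communication -/

/-- An S-1W-LOCC operation: Bob applies an instrument `{bob w}_w`, i.e. completely positive maps
whose sum is trace non-increasing, and sends the outcome `w` to Alice, who applies the classical
processing `alice w`. -/
structure OneWayLOCC (nA nX d nA' nX' d' : ℕ) where
  W : Type
  [fintypeW : Fintype W]
  bob : W → (Op d →ₗ[ℂ] Op d')
  bob_cp : ∀ w, IsCompletelyPositive (bob w)
  bob_tni : ∀ ρ : Op d, ρ.PosSemidef → (∑ w, (bob w ρ).trace).re ≤ ρ.trace.re
  alice : W → Comb nA nX nA' nX'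

attribute [instance] OneWayLOCC.fintypeW

/-- The operation is a (deterministic) 1W-LOCC operation: Bob's instrument is complete. -/
def OneWayLOCC.IsDeterministic {nA nX d nA' nX' d' : ℕ} (T : OneWayLOCC nA nX d nA' nX' d') :
    Prop :=
  ∀ ρ : Op d, ∑ w, (T.bob w ρ).trace = ρ.trace

/-- The unnormalised result of the operation,
`∑_w ∑_{a,x} p(a', x | x', a, w) bob_w(σ_{a|x})`. -/
def OneWayLOCC.apply {nA nX d nA' nX' d' : ℕ} (T : OneWayLOCC nA nX d nA' nX' d')
    (σ : Fin nA → Fin nX → Op d) (a' : Fin nA') (x' : Fin nX') : Op d' :=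
  ∑ w, branch (T.alice w) (T.bob w) σ a' x'

/-- The operation succeeds with probability `P > 0` on the assemblage `Σ`, and the (normalised)
result is the assemblage `Σ'`. -/
def OneWayLOCC.Converts {nA nX d nA' nX' d' : ℕ} (T : OneWayLOCC nA nX d nA' nX' d') (P : ℝ)
    (S : Assemblage nA nX d) (S' : Assemblage nA' nX' d') : Prop :=
  0 < P ∧ ∀ a' x', T.apply S.σ a' x' = (P : ℂ) • S'.σ a' x'

/-- `R` can be converted into `S` by an S-1W-LOCC operation, with non-zero probability. -/
def S1WConvertible (R S : Resource) : Prop :=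
  ∃ (T : OneWayLOCC R.nA R.nX R.d S.nA S.nX S.d) (P : ℝ), T.Converts P R.asm S.asm

/-- `R` can be converted into `S` by a deterministic 1W-LOCC operation. -/
def Det1WConvertible (R S : Resource) : Prop :=
  ∃ T : OneWayLOCC R.nA R.nX R.d S.nA S.nX S.d, T.IsDeterministic ∧ T.Converts 1 R.asm S.asm

/-- The identity operation. -/
def OneWayLOCC.id (nA nX d : ℕ) : OneWayLOCC nA nX d nA nX d where
  W := Unit
  bob _ := LinearMap.id
  bob_cp _ := isCompletelyPositive_id _
  bob_tni ρ _ := by simp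
  alice _ := Comb.ofFun _root_.id fun a _ => a

theorem OneWayLOCC.id_isDeterministic (nA nX d : ℕ) :
    (OneWayLOCC.id nA nX d).IsDeterministic := fun ρ =>
  show ∑ _w : Unit, ρ.trace = ρ.trace by simp

theorem OneWayLOCC.id_converts {nA nX d : ℕ} (S : Assemblage nA nX d) :
    (OneWayLOCC.id nA nX d).Converts 1 S S := by
  refine ⟨one_pos, fun a x => ?_⟩
  change ∑ _w : Unit, branch (Comb.ofFun _root_.id fun a _ => a) LinearMap.id S.σ a x = _
  simp [branch_id]

/-- Sequential composition: `U` is applied first, `V` to its result. -/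
def OneWayLOCC.comp {nA nX d nA' nX' d' nA'' nX'' d'' : ℕ}
    (V : OneWayLOCC nA' nX' d' nA'' nX'' d'') (U : OneWayLOCC nA nX d nA' nX' d') :
    OneWayLOCC nA nX d nA'' nX'' d'' where
  W := V.W × U.W
  bob w := V.bob w.1 ∘ₗ U.bob w.2
  bob_cp w := (V.bob_cp _).comp (U.bob_cp _)
  bob_tni ρ hρ := by
    refine le_trans ?_ (U.bob_tni ρ hρ)
    rw [Fintype.sum_prod_type, Finset.sum_comm, Complex.re_sum, Complex.re_sum]
    exact Finset.sum_le_sum fun w _ => V.bob_tni _ ((U.bob_cp w).posSemidef hρ)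
  alice w := (V.alice w.1).comp (U.alice w.2)

theorem OneWayLOCC.IsDeterministic.comp {nA nX d nA' nX' d' nA'' nX'' d'' : ℕ}
    {V : OneWayLOCC nA' nX' d' nA'' nX'' d''} {U : OneWayLOCC nA nX d nA' nX' d'}
    (hV : V.IsDeterministic) (hU : U.IsDeterministic) : (V.comp U).IsDeterministic := by
  intro ρ
  have h : ∑ w : V.W × U.W, (V.bob w.1 (U.bob w.2 ρ)).trace = ρ.trace := by
    rw [Fintype.sum_prod_type, Finset.sum_comm]
    exact (Finset.sum_congr rfl fun w _ => hV (U.bob w ρ)).trans (hU ρ)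
  exact h

theorem OneWayLOCC.Converts.comp {nA nX d nA' nX' d' nA'' nX'' d'' : ℕ}
    {V : OneWayLOCC nA' nX' d' nA'' nX'' d''} {U : OneWayLOCC nA nX d nA' nX' d'} {P Q : ℝ}
    {S : Assemblage nA nX d} {S' : Assemblage nA' nX' d'} {S'' : Assemblage nA'' nX'' d''}
    (hV : V.Converts Q S' S'') (hU : U.Converts P S S') :
    (V.comp U).Converts (P * Q) S S'' := by
  refine ⟨mul_pos hU.1 hV.1, fun a'' x'' => ?_⟩
  have hP : (P : ℂ) ≠ 0 := Complex.ofReal_ne_zero.mpr hU.1.ne'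
  have hS : S'.σ = fun a x => ∑ w, (P : ℂ)⁻¹ • branch (U.alice w) (U.bob w) S.σ a x := by
    funext a x
    rw [← Finset.smul_sum]
    exact (inv_smul_smul₀ hP (S'.σ a x)).symm.trans (congrArg _ (hU.2 a x).symm)
  rw [Complex.ofReal_mul, mul_smul, ← hV.2 a'' x'']
  change ∑ w : V.W × U.W, branch ((V.alice w.1).comp (U.alice w.2))
    (V.bob w.1 ∘ₗ U.bob w.2) S.σ a'' x'' = _
  simp only [OneWayLOCC.apply]
  rw [hS, Fintype.sum_prod_type, Finset.smul_sum]
  refine Finset.sum_congr rfl fun w _ => ?_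
  rw [branch_sum_smul, Finset.smul_sum]
  refine Finset.sum_congr rfl fun v _ => ?_
  rw [branch_comp, smul_inv_smul₀ hP]

/-- The pre-order of assemblages under S-1W-LOCC: `R ≤ S` if `S` can be converted into `R`. -/
abbrev s1wPreorder : Preorder Resource where
  le R S := S1WConvertible S R
  le_refl _ := ⟨_, _, OneWayLOCC.id_converts _⟩
  le_trans := by
    rintro _ _ _ ⟨V, _, hV⟩ ⟨U, _, hU⟩
    exact ⟨_, _, hV.comp hU⟩

/-- The pre-order of assemblages under deterministic 1W-LOCC: `R ≤ S` if `S` can be converted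
into `R`. -/
abbrev det1wPreorder : Preorder Resource where
  le R S := Det1WConvertible S R
  le_refl _ := ⟨_, OneWayLOCC.id_isDeterministic _ _ _, OneWayLOCC.id_converts _⟩
  le_trans := by
    rintro _ _ _ ⟨V, hVd, hV⟩ ⟨U, hUd, hU⟩
    exact ⟨_, hVd.comp hUd, by simpa using hV.comp hU⟩

/-! ### The family `Σ^{θ,p}` -/

/-- The Pauli matrices `σ_z` (setting `0`) and `σ_x` (setting `1`). -/
def pauliZX (x : Fin 2) : Op 2 := if x = 0 then !![1, 0; 0, -1] else !![0, 1; 1, 0]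

/-- Alice's projective measurements `(1 + (-1)^a σ_z)/2` and `(1 + (-1)^a σ_x)/2`. -/
noncomputable def aliceMeas (a x : Fin 2) : Op 2 :=
  (2⁻¹ : ℂ) • (1 + (-1 : ℂ) ^ (a : ℕ) • pauliZX x)

/-- The two-qubit vector `cos θ |00⟩ + sin θ |11⟩`. -/
noncomputable def ketTheta (θ : ℝ) (i : Fin 2 × Fin 2) : ℂ :=
  if i = (0, 0) then (cos θ : ℂ) else if i = (1, 1) then (sin θ : ℂ) else 0

/-- The projector `|θ⟩⟨θ|`. -/
noncomputable def projTheta (θ : ℝ) : Matrix (Fin 2 × Fin 2) (Fin 2 × Fin 2) ℂ :=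
  Matrix.vecMulVec (ketTheta θ) (star (ketTheta θ))

/-- `σ^θ_{a|x} = tr_A[(M_{a|x} ⊗ 1) |θ⟩⟨θ|]`. -/
noncomputable def sigmaTheta (θ : ℝ) (a x : Fin 2) : Op 2 :=
  ptraceA ((aliceMeas a x ⊗ₖ (1 : Op 2)) * projTheta θ)

theorem aliceMeas_posSemidef (a x : Fin 2) : (aliceMeas a x).PosSemidef := by
  have h : aliceMeas a x = (aliceMeas a x)ᴴ * aliceMeas a x := by
    ext i j
    fin_cases a <;> fin_cases x <;> fin_cases i <;> fin_cases j <;>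
      simp [aliceMeas, pauliZX, Matrix.mul_apply, Fin.sum_univ_two] <;>
      norm_num [show (starRingEnd ℂ) 2 = 2 from Complex.conj_ofNat 2]
  rw [h]
  exact Matrix.posSemidef_conjTranspose_mul_self _

theorem sum_aliceMeas (x : Fin 2) : ∑ a, aliceMeas a x = 1 := by
  ext i j
  fin_cases x <;> fin_cases i <;> fin_cases j <;>
    simp [aliceMeas, pauliZX, Fin.sum_univ_two] <;> norm_num

/-- The assemblage `Σ^{θ,p} = {p σ^θ_{a|x} + (1 - p) 1/4}`. -/
noncomputable def sigmaFamily (θ : ℝ) (p : Set.Icc (0 : ℝ) 1) : Assemblage 2 2 2 where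
  σ a x := ((p : ℝ) : ℂ) • sigmaTheta θ a x + ((1 - (p : ℝ) : ℝ) : ℂ) • ((4⁻¹ : ℂ) • (1 : Op 2))
  realizable := by
    refine ⟨2, ((p : ℝ) : ℂ) • projTheta θ + ((1 - (p : ℝ) : ℝ) : ℂ) • ((4⁻¹ : ℂ) • 1),
      aliceMeas, ?_, ?_, aliceMeas_posSemidef, sum_aliceMeas, fun a x => ?_⟩
    · refine Matrix.PosSemidef.add ?_ ?_
      · exact (Matrix.posSemidef_vecMulVec_self_star _).smul (by exact_mod_cast p.2.1)
      · refine Matrix.PosSemidef.smul (Matrix.PosSemidef.smul Matrix.PosSemidef.one ?_) ?_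
        · rw [show (4⁻¹ : ℂ) = ((4⁻¹ : ℝ) : ℂ) by norm_num]
          exact_mod_cast (by norm_num : (0 : ℝ) ≤ 4⁻¹)
        · exact_mod_cast sub_nonneg.mpr p.2.2
    · have h : (projTheta θ).trace = 1 := by
        simp [Matrix.trace, projTheta, Matrix.vecMulVec_apply, Fintype.sum_prod_type,
          Fin.sum_univ_two, ketTheta, Complex.conj_ofReal, -Complex.ofReal_cos,
          -Complex.ofReal_sin]
        exact_mod_cast (by nlinarith [Real.cos_sq_add_sin_sq θ] :
          cos θ * cos θ + sin θ * sin θ = 1)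
      simp [Matrix.trace_add, h]
    · have h1 : (aliceMeas a x).trace = 1 := by
        fin_cases a <;> fin_cases x <;>
          simp [aliceMeas, pauliZX, Matrix.trace, Fin.sum_univ_two] <;> norm_num
      have h2 : ptraceA (aliceMeas a x ⊗ₖ (1 : Op 2)) = 1 := by
        ext i j
        calc _ = ∑ k, aliceMeas a x k k * (1 : Op 2) i j := rfl
          _ = (aliceMeas a x).trace * (1 : Op 2) i j := (Finset.sum_mul ..).symm
          _ = _ := by rw [h1, one_mul]
      have hadd : ∀ (c c' : ℂ) (ρ τ : Matrix (Fin 2 × Fin 2) (Fin 2 × Fin 2) ℂ),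
          ptraceA (c • ρ + c' • τ) = c • ptraceA ρ + c' • ptraceA τ := by
        intro c c' ρ τ
        ext i j
        simp [ptraceA, Fin.sum_univ_two]
        ring
      simp only [smul_smul, Matrix.mul_add, Matrix.mul_smul, Matrix.mul_one, hadd]
      rw [h2]
      rfl

/-- `Σ^{θ,p}` as a resource. -/
noncomputable def sigmaResource (θ : ℝ) (p : Set.Icc (0 : ℝ) 1) : Resource where
  nA := 2
  nX := 2
  d := 2
  nX_pos := two_pos
  asm := sigmaFamily θ p

/-! ### The two explicit S-1W-LOCC operations -/

/-- The Kraus operators `M_0 = cos θ |0⟩⟨0| + sin θ |1⟩⟨1|` and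
`M_1 = sin θ |1⟩⟨0| + cos θ |0⟩⟨1|`. -/
noncomputable def krausM (θ : ℝ) (w : Fin 2) : Op 2 :=
  if w = 0 then !![(cos θ : ℂ), 0; 0, (sin θ : ℂ)] else !![0, (cos θ : ℂ); (sin θ : ℂ), 0]

theorem trace_krausM (θ : ℝ) (ρ : Op 2) :
    (krausMap (krausM θ 0) ρ).trace + (krausMap (krausM θ 1) ρ).trace = ρ.trace := by
  have h : (cos θ : ℂ) * cos θ + sin θ * sin θ = 1 := by
    exact_mod_cast (by nlinarith [Real.cos_sq_add_sin_sq θ] :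
      cos θ * cos θ + sin θ * sin θ = 1)
  simp only [krausMap, krausM, Matrix.trace, Matrix.diag, LinearMap.coe_mk, AddHom.coe_mk,
    Matrix.mul_apply, Fin.sum_univ_two, Matrix.conjTranspose_apply]
  simp [-Complex.ofReal_cos, -Complex.ofReal_sin]
  linear_combination (ρ 0 0 + ρ 1 1) * h

/-- The instrument with the single map `M_0 · M_0†`; Alice does nothing (`x = x'`, `a' = a`). -/
noncomputable def stochasticOp (θ : ℝ) : OneWayLOCC 2 2 2 2 2 2 where
  W := Unit
  bob _ := krausMap (krausM θ 0)
  bob_cp _ := isCompletelyPositive_krausMap _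
  bob_tni ρ hρ := by
    have h := congrArg Complex.re (trace_krausM θ ρ)
    have h1 := (Complex.nonneg_iff.mp
      ((isCompletelyPositive_krausMap (krausM θ 1)).posSemidef hρ).trace_nonneg).1
    simp only [Complex.add_re] at h
    simp only [Finset.univ_unique, Finset.sum_singleton]
    linarith
  alice _ := Comb.ofFun id fun a _ => a

/-- The instrument with the two maps `M_w · M_w†`, `w = 0, 1`; Alice uses the input `x = x'` and
outputs `a' = a ⊕ xw ⊕ w`, i.e. flips her outcome iff `x = 0` and `w = 1`. -/
noncomputable def deterministicOp (θ : ℝ) : OneWayLOCC 2 2 2 2 2 2 where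
  W := Fin 2
  bob w := krausMap (krausM θ w)
  bob_cp _ := isCompletelyPositive_krausMap _
  bob_tni ρ _ := by rw [Fin.sum_univ_two, trace_krausM]
  alice w := Comb.ofFun id fun a x => a + x * w + w

/-!
Suppose an LOSR operation produces pure states. A positive operator below a multiple of a rank-one
projector is itself a multiple of it, so every branch of positive weight already does the
conversion up to normalisation: for one channel `Φ`, one input `x = g x'` and one output
`a' = f x' a` per outcome, `Φ (σ_{a|g x'})` is `p(a|g x')` times the target state of `a'` and `x'`.
As `∑ a, σ_{a|x}` does not depend on `x`, converting `Σ^{θ₁,1}` into `Σ^{θ₂,1}` yields, for the two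
settings, mixtures of target states with the weights of `Σ^{θ₁,1}` and equal averages. The target
states of setting `0` are diagonal, while those of setting `1` have the same diagonal and opposite
nonzero coherences; hence `g` is a permutation, and comparing entries of the averages shows that
`∏ a, p(a|g x')` in the source equals `∏ a, p(a|x')` in the target. Summing over the settings shows
that `sin² 2θ` is preserved.

Communication removes this rigidity: for Alice's projectors `Π_{a|x}`,
`σ^θ_{a|x} = M_0 Π_{a|x} M_0†` and `σ^{π/4}_{a|x} = Π_{a|x} / 2`, so `M_0` turns `Σ^{π/4,1}` into
`Σ^{θ,1}` with probability `1/2`. The complementary operator is `M_1 = M_0 σ_x`, and conjugation by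
`σ_x` merely swaps the outcomes of `σ_z`, which Alice can undo. White noise is reached by preparing
it afresh with probability `1 - p`.
-/

section PartialTrace

variable {m d : ℕ}

theorem ptraceA_sum {ι : Type*} (s : Finset ι)
    (ρ : ι → Matrix (Fin m × Fin d) (Fin m × Fin d) ℂ) :
    ptraceA (∑ i ∈ s, ρ i) = ∑ i ∈ s, ptraceA (ρ i) := by
  ext i j
  simp only [ptraceA, of_apply, Matrix.sum_apply]
  exact Finset.sum_comm

theorem trace_ptraceA (ρ : Matrix (Fin m × Fin d) (Fin m × Fin d) ℂ) :
    (ptraceA ρ).trace = ρ.trace := by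
  simp only [trace, diag, ptraceA, of_apply, Fintype.sum_prod_type]
  exact Finset.sum_comm

theorem posSemidef_ptraceA {ρ : Matrix (Fin m × Fin d) (Fin m × Fin d) ℂ} (hρ : ρ.PosSemidef) :
    (ptraceA ρ).PosSemidef := by
  have h : ptraceA ρ = ∑ k, ρ.submatrix (Prod.mk k) (Prod.mk k) := by
    ext i j
    simp [ptraceA, Matrix.sum_apply]
  rw [h]
  exact posSemidef_sum _ fun k _ => hρ.submatrix _

theorem ptraceA_kronecker_one_mul_comm (N : Op m)
    (ρ : Matrix (Fin m × Fin d) (Fin m × Fin d) ℂ) :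
    ptraceA ((N ⊗ₖ (1 : Op d)) * ρ) = ptraceA (ρ * (N ⊗ₖ (1 : Op d))) := by
  ext i j
  simp only [ptraceA, of_apply, mul_apply, Fintype.sum_prod_type, kronecker_apply, one_apply,
    mul_ite, mul_one, mul_zero, ite_mul, zero_mul, Finset.sum_ite_eq, Finset.sum_ite_eq',
    Finset.mem_univ, if_true]
  rw [Finset.sum_comm]
  exact Finset.sum_congr rfl fun _ _ => Finset.sum_congr rfl fun _ _ => mul_comm _ _

open scoped MatrixOrder in
theorem posSemidef_ptraceA_kronecker_one_mul {M : Op m} (hM : M.PosSemidef)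
    {ρ : Matrix (Fin m × Fin d) (Fin m × Fin d) ℂ} (hρ : ρ.PosSemidef) :
    (ptraceA ((M ⊗ₖ (1 : Op d)) * ρ)).PosSemidef := by
  obtain ⟨N, rfl⟩ := CStarAlgebra.nonneg_iff_eq_star_mul_self.mp hM.nonneg
  have hN : (star N * N) ⊗ₖ (1 : Op d) = (Nᴴ ⊗ₖ 1) * (N ⊗ₖ 1) := by
    rw [← mul_kronecker_mul, one_mul, star_eq_conjTranspose]
  have hadj : Nᴴ ⊗ₖ (1 : Op d) = (N ⊗ₖ 1)ᴴ := by
    rw [conjTranspose_kronecker, conjTranspose_one]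
  rw [hN, Matrix.mul_assoc, ptraceA_kronecker_one_mul_comm, hadj]
  exact posSemidef_ptraceA (hρ.mul_mul_conjTranspose_same _)

end PartialTrace

namespace Assemblage

variable {nA nX d : ℕ} (S : Assemblage nA nX d)

theorem posSemidef (a : Fin nA) (x : Fin nX) : (S.σ a x).PosSemidef := by
  obtain ⟨m, ρ, M, hρ, -, hM, -, hσ⟩ := S.realizable
  rw [hσ]
  exact posSemidef_ptraceA_kronecker_one_mul (hM a x) hρ

theorem exists_sum_eq : ∃ τ : Op d, τ.trace = 1 ∧ ∀ x, ∑ a, S.σ a x = τ := by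
  obtain ⟨m, ρ, M, -, hρ, -, hM, hσ⟩ := S.realizable
  refine ⟨ptraceA ρ, by rw [trace_ptraceA, hρ], fun x => ?_⟩
  have hsum : ∑ a, (M a x ⊗ₖ (1 : Op d)) = 1 := by
    ext ⟨k, i⟩ ⟨l, j⟩
    simp only [Matrix.sum_apply, kronecker_apply, ← Finset.sum_mul]
    rw [← Matrix.sum_apply, hM, ← kronecker_apply, one_kronecker_one]
  simp only [hσ]
  rw [← ptraceA_sum, ← Finset.sum_mul, hsum, one_mul]

theorem sum_eq_sum (x y : Fin nX) : ∑ a, S.σ a x = ∑ a, S.σ a y := by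
  obtain ⟨τ, -, hτ⟩ := S.exists_sum_eq
  rw [hτ, hτ]

theorem sum_trace (x : Fin nX) : ∑ a, (S.σ a x).trace = 1 := by
  obtain ⟨τ, hτ, hsum⟩ := S.exists_sum_eq
  rw [← trace_sum, hsum, hτ]

end Assemblage

/-- The operator `|ψ⟩⟨ψ|`, a pure state when `ψ` is a unit vector. -/
abbrev pureState {n : Type*} (ψ : n → ℂ) : Matrix n n ℂ := vecMulVec ψ (star ψ)

section PureState

open scoped MatrixOrder

variable {n : Type*} [Fintype n]

theorem mulVec_eq_zero_of_le_smul_pureState {T : Matrix n n ℂ} (hT : T.PosSemidef) {c : ℂ}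
    {ψ v : n → ℂ} (hle : T ≤ c • pureState ψ) (hv : star ψ ⬝ᵥ v = 0) : T *ᵥ v = 0 := by
  have hψv : (c • pureState ψ) *ᵥ v = 0 := by
    rw [smul_mulVec, vecMulVec_mulVec, hv, MulOpposite.op_zero, zero_smul, smul_zero]
  have hnonpos : star v ⬝ᵥ T *ᵥ v ≤ 0 := by
    have h := (le_iff.mp hle).dotProduct_mulVec_nonneg v
    rwa [sub_mulVec, hψv, zero_sub, dotProduct_neg, neg_nonneg] at h
  exact (hT.dotProduct_mulVec_zero_iff v).mp (hnonpos.antisymm (hT.dotProduct_mulVec_nonneg v))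

theorem eq_trace_smul_pureState_of_le {T : Matrix n n ℂ} (hT : T.PosSemidef) {c : ℂ} {ψ : n → ℂ}
    (hψ : star ψ ⬝ᵥ ψ = 1) (hle : T ≤ c • pureState ψ) : T = T.trace • pureState ψ := by
  classical
  have hright : T = T * pureState ψ := by
    refine Matrix.ext_of_mulVec_single fun i => ?_
    have hv : star ψ ⬝ᵥ (Pi.single i 1 - pureState ψ *ᵥ Pi.single i 1) = 0 := by
      rw [dotProduct_sub, dotProduct_mulVec, vecMul_vecMulVec, hψ, one_smul, sub_self]
    rw [← mulVec_mulVec, ← sub_eq_zero, ← mulVec_sub]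
    exact mulVec_eq_zero_of_le_smul_pureState hT hle hv
  have hleft : T = pureState ψ * T := by
    have h := congrArg conjTranspose hright
    rwa [conjTranspose_mul, hT.1.eq, conjTranspose_vecMulVec, star_star] at h
  have hT' : T = (star ψ ⬝ᵥ T *ᵥ ψ) • pureState ψ := by
    conv_lhs => rw [hleft, hright]
    rw [mul_vecMulVec, vecMulVec_mul_vecMulVec, vecMulVec_smul]
  have htr : T.trace = star ψ ⬝ᵥ T *ᵥ ψ := by
    conv_lhs => rw [hT', trace_smul, trace_vecMulVec, dotProduct_comm ψ, hψ, smul_eq_mul, mul_one]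
  rwa [htr]

end PureState

section LOSR

open scoped MatrixOrder

variable {nA nX d nA' nX' d' : ℕ}

theorem Comb.exists_prob_pos (C : Comb nA nX nA' nX') (x' : Fin nX') :
    ∃ x, ∀ a, ∃ a', 0 < C.prob a' x x' a := by
  obtain ⟨x, hx⟩ : ∃ x, 0 < C.inp x x' := by
    by_contra! h
    exact (C.sum_inp x' ▸ Finset.sum_nonpos fun x _ => h x).not_gt one_pos
  refine ⟨x, fun a => ?_⟩
  by_contra! h
  exact (C.no_retro x x' a ▸ Finset.sum_nonpos fun a' _ => h a').not_gt hx

namespace LOSROp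

variable (T : LOSROp nA nX d nA' nX' d')

theorem exists_p_pos : ∃ l, 0 < T.p l := by
  by_contra! h
  exact (T.sum_p ▸ Finset.sum_nonpos fun l _ => h l).not_gt one_pos

theorem smul_bob_le_apply {σ : Fin nA → Fin nX → Op d} (hσ : ∀ a x, (σ a x).PosSemidef)
    (l : T.L) (a : Fin nA) (x : Fin nX) (a' : Fin nA') (x' : Fin nX') :
    ((T.p l * (T.alice l).prob a' x x' a : ℝ) : ℂ) • T.bob l (σ a x) ≤ T.apply σ a' x' := by
  have hterm : ∀ l a x, 0 ≤ (((T.alice l).prob a' x x' a : ℝ) : ℂ) • T.bob l (σ a x) :=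
    fun l a x => nonneg_iff_posSemidef.mpr <| ((T.bob_cp l).posSemidef (hσ a x)).smul <|
      Complex.zero_le_real.mpr ((T.alice l).nonneg ..)
  have hbranch : ∀ l, 0 ≤ branch (T.alice l) (T.bob l) σ a' x' :=
    fun l => Finset.sum_nonneg fun a _ => Finset.sum_nonneg fun x _ => hterm l a x
  have hp : ∀ l (A : Op d'), 0 ≤ A → 0 ≤ ((T.p l : ℝ) : ℂ) • A := fun l A hA =>
    nonneg_iff_posSemidef.mpr <|
      (nonneg_iff_posSemidef.mp hA).smul (Complex.zero_le_real.mpr (T.p_nonneg l))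
  have hle : (((T.alice l).prob a' x x' a : ℝ) : ℂ) • T.bob l (σ a x) ≤
      branch (T.alice l) (T.bob l) σ a' x' :=
    (Finset.single_le_sum (fun x _ => hterm l a x) (Finset.mem_univ x)).trans <|
      Finset.single_le_sum (f := fun a => ∑ x, (((T.alice l).prob a' x x' a : ℝ) : ℂ) •
        T.bob l (σ a x)) (fun a _ => Finset.sum_nonneg fun x _ => hterm l a x) (Finset.mem_univ a)
  calc ((T.p l * (T.alice l).prob a' x x' a : ℝ) : ℂ) • T.bob l (σ a x)
      = ((T.p l : ℝ) : ℂ) • (((T.alice l).prob a' x x' a : ℝ) : ℂ) • T.bob l (σ a x) := by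
        rw [Complex.ofReal_mul, mul_smul]
    _ ≤ ((T.p l : ℝ) : ℂ) • branch (T.alice l) (T.bob l) σ a' x' := by
        rw [← sub_nonneg, ← smul_sub]
        exact hp l _ (sub_nonneg.mpr hle)
    _ ≤ T.apply σ a' x' :=
        Finset.single_le_sum (f := fun l => ((T.p l : ℝ) : ℂ) •
          branch (T.alice l) (T.bob l) σ a' x') (fun l _ => hp l _ (hbranch l)) (Finset.mem_univ l)

theorem bob_eq_trace_smul_pureState {σ : Fin nA → Fin nX → Op d}
    (hσ : ∀ a x, (σ a x).PosSemidef) {l : T.L} {a : Fin nA} {x : Fin nX} {a' : Fin nA'}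
    {x' : Fin nX'} (hl : 0 < T.p l) (hprob : 0 < (T.alice l).prob a' x x' a) {c : ℂ}
    {ψ : Fin d' → ℂ} (hψ : star ψ ⬝ᵥ ψ = 1) (hT : T.apply σ a' x' = c • pureState ψ) :
    T.bob l (σ a x) = (σ a x).trace • pureState ψ := by
  have hweight := mul_pos hl hprob
  have h := eq_trace_smul_pureState_of_le
    (((T.bob_cp l).posSemidef (hσ a x)).smul (Complex.zero_le_real.mpr hweight.le)) hψ
    (hT ▸ T.smul_bob_le_apply hσ l a x a' x')
  rw [trace_smul, smul_assoc, T.bob_tp l] at h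
  exact smul_right_injective _ (Complex.ofReal_ne_zero.mpr hweight.ne') h

end LOSROp

theorem LOSRConvertible.exists_map_eq_trace_smul_pureState {R S : Resource}
    (h : LOSRConvertible R S) {c : Fin S.nA → Fin S.nX → ℂ}
    {ψ : Fin S.nA → Fin S.nX → Fin S.d → ℂ} (hψ : ∀ a x, star (ψ a x) ⬝ᵥ ψ a x = 1)
    (hS : ∀ a x, S.asm.σ a x = c a x • pureState (ψ a x)) :
    ∃ (Φ : Op R.d →ₗ[ℂ] Op S.d) (g : Fin S.nX → Fin R.nX)
      (f : Fin S.nX → Fin R.nA → Fin S.nA), ∀ a x',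
      Φ (R.asm.σ a (g x')) = (R.asm.σ a (g x')).trace • pureState (ψ (f x' a) x') := by
  obtain ⟨T, hT⟩ := h
  obtain ⟨l, hl⟩ := T.exists_p_pos
  choose g f hf using (T.alice l).exists_prob_pos
  exact ⟨T.bob l, g, f, fun a x' => T.bob_eq_trace_smul_pureState R.asm.posSemidef hl (hf x' a)
    (hψ _ _) ((hT _ _).trans (hS _ _))⟩

end LOSR

section Steering

theorem ptraceA_kronecker_one_mul_pureState {m d : ℕ} (M : Op m)
    (A : Matrix (Fin d) (Fin m) ℂ) :
    ptraceA ((M ⊗ₖ (1 : Op d)) * pureState fun i => A i.2 i.1) = krausMap A Mᵀ := by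
  ext i j
  simp only [ptraceA, krausMap, of_apply, LinearMap.coe_mk, AddHom.coe_mk, mul_apply,
    Fintype.sum_prod_type, kronecker_apply, one_apply, mul_ite, mul_one, mul_zero, ite_mul,
    zero_mul, Finset.sum_ite_eq, Finset.mem_univ, if_true, vecMulVec_apply, Pi.star_apply,
    conjTranspose_apply, transpose_apply, Finset.sum_mul]
  exact Finset.sum_congr rfl fun _ _ => Finset.sum_congr rfl fun _ _ => by ring

theorem krausMap_mul {d e f : ℕ} (A : Matrix (Fin f) (Fin e) ℂ) (B : Matrix (Fin e) (Fin d) ℂ)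
    (ρ : Op d) : krausMap (A * B) ρ = krausMap A (krausMap B ρ) := by
  simp only [krausMap, LinearMap.coe_mk, AddHom.coe_mk, conjTranspose_mul, Matrix.mul_assoc]

theorem krausMap_smul_one {d : ℕ} (c : ℂ) (ρ : Op d) :
    krausMap (c • 1) ρ = (c * star c) • ρ := by
  simp [krausMap, smul_smul, mul_comm]

theorem ketTheta_eq (θ : ℝ) : ketTheta θ = fun i => krausM θ 0 i.2 i.1 := by
  funext ⟨i, j⟩
  fin_cases i <;> fin_cases j <;> simp [ketTheta, krausM]

theorem aliceMeas_transpose (a x : Fin 2) : (aliceMeas a x)ᵀ = aliceMeas a x := by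
  have h : (pauliZX x)ᵀ = pauliZX x := by
    ext i j
    fin_cases x <;> fin_cases i <;> fin_cases j <;> simp [pauliZX]
  rw [aliceMeas, transpose_smul, transpose_add, transpose_smul, transpose_one, h]

theorem sigmaTheta_eq_krausMap (θ : ℝ) (a x : Fin 2) :
    sigmaTheta θ a x = krausMap (krausM θ 0) (aliceMeas a x) := by
  rw [sigmaTheta, projTheta, ketTheta_eq]
  exact (ptraceA_kronecker_one_mul_pureState _ _).trans (by rw [aliceMeas_transpose])

theorem sigmaFamily_one_σ (θ : ℝ) : (sigmaFamily θ 1).σ = sigmaTheta θ := by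
  funext a x
  simp [sigmaFamily]

theorem sigmaTheta_pi_div_four (a x : Fin 2) :
    sigmaTheta (π / 4) a x = (1 / 2 : ℂ) • aliceMeas a x := by
  have hM : krausM (π / 4) 0 = ((√2 / 2 : ℝ) : ℂ) • 1 := by
    rw [krausM, if_pos rfl, cos_pi_div_four, sin_pi_div_four, one_fin_two, smul_of]
    simp
  have hc : ((√2 / 2 : ℝ) : ℂ) * star ((√2 / 2 : ℝ) : ℂ) = 1 / 2 := by
    rw [Complex.star_def, Complex.conj_ofReal, ← Complex.ofReal_mul, div_mul_div_comm,
      mul_self_sqrt zero_le_two]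
    norm_num
  rw [sigmaTheta_eq_krausMap, hM, krausMap_smul_one, hc]

theorem krausM_one (θ : ℝ) : krausM θ 1 = krausM θ 0 * pauliZX 1 := by
  simp [krausM, pauliZX]

theorem krausMap_pauliZX_one_aliceMeas (a x : Fin 2) :
    krausMap (pauliZX 1) (aliceMeas a x) = aliceMeas (a + x + 1) x := by
  ext i j
  simp only [krausMap, LinearMap.coe_mk, AddHom.coe_mk, mul_apply, Fin.sum_univ_two,
    conjTranspose_apply]
  fin_cases a <;> fin_cases x <;> fin_cases i <;> fin_cases j <;>
    simp [aliceMeas, pauliZX]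

theorem krausMap_krausM_sigmaTheta_pi_div_four (θ : ℝ) (w a x : Fin 2) :
    krausMap (krausM θ w) (sigmaTheta (π / 4) a x) =
      (1 / 2 : ℂ) • sigmaTheta θ (a + x * w + w) x := by
  rw [sigmaTheta_pi_div_four, map_smul, sigmaTheta_eq_krausMap]
  fin_cases w
  · simp
  · simp [krausM_one, krausMap_mul, krausMap_pauliZX_one_aliceMeas]

end Steering

section SteeredEnsemble

/-- The probability `p(a|x) = tr σ^θ_{a|x}` of Alice's outcome `a` in setting `x`. -/
noncomputable def steeredProb (θ : ℝ) (a x : Fin 2) : ℝ :=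
  if x = 0 then (if a = 0 then cos θ ^ 2 else sin θ ^ 2) else 1 / 2

/-- The pure state of Bob's system when Alice obtains the outcome `a` in setting `x`. -/
noncomputable def steeredVec (θ : ℝ) (a x : Fin 2) : Fin 2 → ℂ :=
  if x = 0 then Pi.single a 1 else ![(cos θ : ℂ), (-1) ^ (a : ℕ) * (sin θ : ℂ)]

theorem star_steeredVec_dotProduct_self (θ : ℝ) (a x : Fin 2) :
    star (steeredVec θ a x) ⬝ᵥ steeredVec θ a x = 1 := by
  have h : (cos θ : ℂ) * cos θ + sin θ * sin θ = 1 := by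
    exact_mod_cast (by rw [← sq, ← sq, cos_sq_add_sin_sq] : cos θ * cos θ + sin θ * sin θ = 1)
  fin_cases a <;> fin_cases x <;>
    simp [steeredVec, dotProduct, Fin.sum_univ_two, Complex.conj_ofReal, h, -Complex.ofReal_cos,
      -Complex.ofReal_sin]

theorem sigmaTheta_eq_smul_pureState (θ : ℝ) (a x : Fin 2) :
    sigmaTheta θ a x = (steeredProb θ a x : ℂ) • pureState (steeredVec θ a x) := by
  rw [sigmaTheta_eq_krausMap]
  ext i j
  simp only [krausMap, LinearMap.coe_mk, AddHom.coe_mk, mul_apply, Fin.sum_univ_two,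
    conjTranspose_apply, Matrix.smul_apply, vecMulVec_apply, Pi.star_apply]
  fin_cases a <;> fin_cases x <;> fin_cases i <;> fin_cases j <;>
    simp [krausM, aliceMeas, pauliZX, steeredProb, steeredVec, Complex.conj_ofReal,
      -Complex.ofReal_cos, -Complex.ofReal_sin] <;>
    ring

theorem trace_sigmaTheta (θ : ℝ) (a x : Fin 2) :
    (sigmaTheta θ a x).trace = (steeredProb θ a x : ℂ) := by
  rw [sigmaTheta_eq_smul_pureState, trace_smul, trace_vecMulVec, dotProduct_comm,
    star_steeredVec_dotProduct_self, smul_eq_mul, mul_one]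

theorem sum_steeredProb (θ : ℝ) (x : Fin 2) : ∑ a, steeredProb θ a x = 1 := by
  fin_cases x
  · simp [steeredProb]
  · norm_num [steeredProb]

theorem sum_prod_steeredProb (θ : ℝ) :
    ∑ x, ∏ a, steeredProb θ a x = sin (2 * θ) ^ 2 / 4 + 1 / 4 := by
  simp only [sin_two_mul, Fin.sum_univ_two, Fin.prod_univ_two, steeredProb, if_true, one_ne_zero,
    if_false]
  ring

theorem pureState_steeredVec_zero_apply_zero_zero (θ : ℝ) (a : Fin 2) :
    pureState (steeredVec θ a 0) 0 0 = ((if a = 0 then 1 else 0 : ℝ) : ℂ) := by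
  fin_cases a <;> simp [steeredVec, vecMulVec_apply]

theorem pureState_steeredVec_one_apply_zero_zero (θ : ℝ) (a : Fin 2) :
    pureState (steeredVec θ a 1) 0 0 = ((cos θ ^ 2 : ℝ) : ℂ) := by
  simp [steeredVec, vecMulVec_apply, Complex.conj_ofReal, sq, -Complex.ofReal_cos]

theorem pureState_steeredVec_zero_apply_zero_one (θ : ℝ) (a : Fin 2) :
    pureState (steeredVec θ a 0) 0 1 = 0 := by
  fin_cases a <;> simp [steeredVec, vecMulVec_apply]

theorem pureState_steeredVec_one_apply_zero_one (θ : ℝ) (a : Fin 2) :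
    pureState (steeredVec θ a 1) 0 1 = (((-1) ^ (a : ℕ) * (sin (2 * θ) / 2) : ℝ) : ℂ) := by
  rw [sin_two_mul]
  fin_cases a <;>
    simp [steeredVec, vecMulVec_apply, Complex.conj_ofReal, -Complex.ofReal_cos,
      -Complex.ofReal_sin] <;>
    ring

end SteeredEnsemble

section Incomparability

theorem prod_eq_mul_one_sub_of_sum_ite {u : Fin 2 → ℝ} (hu : ∑ a, u a = 1) {f : Fin 2 → Fin 2}
    {c : ℝ} (hc₀ : c ≠ 0) (hc₁ : c ≠ 1) (h : ∑ a, (if f a = 0 then u a else 0) = c) :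
    ∏ a, u a = c * (1 - c) := by
  rw [Fin.sum_univ_two] at hu h
  rw [Fin.prod_univ_two]
  split_ifs at h with h₀ h₁ h₁
  · exact absurd (h.symm.trans hu) hc₁
  · rw [← h, add_zero, ← hu, add_sub_cancel_left]
  · rw [← h, zero_add, ← hu, add_sub_cancel_right, mul_comm]
  · exact absurd (h.symm.trans (add_zero 0)) hc₀

theorem prod_eq_one_div_four_of_sum_neg_one_pow {u : Fin 2 → ℝ} (hu : ∑ a, u a = 1)
    {f : Fin 2 → Fin 2} (h : ∑ a, (-1) ^ (f a : ℕ) * u a = 0) : ∏ a, u a = 1 / 4 := by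
  have hsign : ∀ b : Fin 2, (-1 : ℝ) ^ (b : ℕ) = 2 * (if b = 0 then 1 else 0) - 1 := by
    intro b
    fin_cases b <;> norm_num
  have hhalf : ∑ a, (if f a = 0 then u a else 0) = 1 / 2 := by
    simp only [hsign, sub_mul, Finset.sum_sub_distrib, one_mul, hu, mul_assoc, ← Finset.mul_sum,
      ite_mul, zero_mul] at h
    linarith
  rw [prod_eq_mul_one_sub_of_sum_ite hu (by norm_num) (by norm_num) hhalf]
  norm_num

theorem sum_ite_eq_of_sum_smul_pureState_eq {θ : ℝ} {u v : Fin 2 → ℝ} (hv : ∑ a, v a = 1)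
    {F G : Fin 2 → Fin 2}
    (h : ∑ a, (u a : ℂ) • pureState (steeredVec θ (F a) 0) =
      ∑ a, (v a : ℂ) • pureState (steeredVec θ (G a) 1)) :
    ∑ a, (if F a = 0 then u a else 0) = cos θ ^ 2 := by
  have hentry := congrFun (congrFun h 0) 0
  simp only [Matrix.sum_apply, Matrix.smul_apply, pureState_steeredVec_zero_apply_zero_zero,
    pureState_steeredVec_one_apply_zero_zero, smul_eq_mul, ← Finset.sum_mul,
    ← Complex.ofReal_sum, hv, ← Complex.ofReal_mul, mul_ite, mul_one, mul_zero, one_mul] at hentry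
  exact Complex.ofReal_injective hentry

theorem sum_neg_one_pow_eq_zero_of_sum_smul_pureState_eq {θ : ℝ} (hθ : sin (2 * θ) ≠ 0)
    {u v : Fin 2 → ℝ} {F G : Fin 2 → Fin 2}
    (h : ∑ a, (u a : ℂ) • pureState (steeredVec θ (F a) 0) =
      ∑ a, (v a : ℂ) • pureState (steeredVec θ (G a) 1)) :
    ∑ a, (-1) ^ (G a : ℕ) * v a = 0 := by
  have hentry := congrFun (congrFun h 0) 1
  simp only [Matrix.sum_apply, Matrix.smul_apply, pureState_steeredVec_zero_apply_zero_one,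
    pureState_steeredVec_one_apply_zero_one, mul_zero, Finset.sum_const_zero, smul_eq_mul,
    ← Complex.ofReal_mul, ← Complex.ofReal_sum] at hentry
  have hprod : (∑ a, (-1) ^ (G a : ℕ) * v a) * (sin (2 * θ) / 2) = 0 := by
    rw [Finset.sum_mul, ← Complex.ofReal_eq_zero, hentry]
    exact congrArg _ (Finset.sum_congr rfl fun a _ => by ring)
  exact (mul_eq_zero.mp hprod).resolve_right (div_ne_zero hθ two_ne_zero)

section

variable {θ₁ θ₂ : ℝ} {Φ : Op 2 →ₗ[ℂ] Op 2} {g : Fin 2 → Fin 2} {f : Fin 2 → Fin 2 → Fin 2}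

theorem injective_of_map_sigmaTheta (hθ : sin (2 * θ₂) ≠ 0)
    (h : ∀ a x, Φ (sigmaTheta θ₁ a (g x)) =
      (steeredProb θ₁ a (g x) : ℂ) • pureState (steeredVec θ₂ (f x a) x)) :
    Function.Injective g := by
  have hne : g 0 ≠ g 1 := by
    intro hg
    obtain ⟨a, -, ha⟩ := Finset.exists_ne_zero_of_sum_ne_zero
      ((sum_steeredProb θ₁ (g 1)).trans_ne one_ne_zero)
    have hstate : pureState (steeredVec θ₂ (f 0 a) 0) = pureState (steeredVec θ₂ (f 1 a) 1) := by
      have h₀ := h a 0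
      rw [hg, h a 1] at h₀
      exact (smul_right_injective _ (Complex.ofReal_ne_zero.mpr ha) h₀).symm
    have hentry := congrFun (congrFun hstate 0) 1
    rw [pureState_steeredVec_zero_apply_zero_one, pureState_steeredVec_one_apply_zero_one, eq_comm,
      Complex.ofReal_eq_zero] at hentry
    exact mul_ne_zero (pow_ne_zero _ (neg_ne_zero.mpr one_ne_zero))
      (div_ne_zero hθ two_ne_zero) hentry
  intro x y
  fin_cases x <;> fin_cases y <;> simp [hne, hne.symm]

theorem sum_steeredProb_smul_pureState_eq
    (h : ∀ a x, Φ (sigmaTheta θ₁ a (g x)) =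
      (steeredProb θ₁ a (g x) : ℂ) • pureState (steeredVec θ₂ (f x a) x)) :
    ∑ a, (steeredProb θ₁ a (g 0) : ℂ) • pureState (steeredVec θ₂ (f 0 a) 0) =
      ∑ a, (steeredProb θ₁ a (g 1) : ℂ) • pureState (steeredVec θ₂ (f 1 a) 1) := by
  have hsum := congrArg Φ ((sigmaFamily θ₁ 1).sum_eq_sum (g 0) (g 1))
  simpa only [sigmaFamily_one_σ, map_sum, h] using hsum

theorem prod_steeredProb_eq_of_map_sigmaTheta (hθ : sin (2 * θ₂) ≠ 0)
    (h : ∀ a x, Φ (sigmaTheta θ₁ a (g x)) =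
      (steeredProb θ₁ a (g x) : ℂ) • pureState (steeredVec θ₂ (f x a) x)) (x : Fin 2) :
    ∏ a, steeredProb θ₁ a (g x) = ∏ a, steeredProb θ₂ a x := by
  have hsum := sum_steeredProb_smul_pureState_eq h
  have hsc := hθ
  rw [sin_two_mul, mul_ne_zero_iff, mul_ne_zero_iff] at hsc
  obtain ⟨⟨-, hsin⟩, hcos⟩ := hsc
  fin_cases x
  · have hcos₁ : cos θ₂ ^ 2 ≠ 1 := by
      rwa [← sub_ne_zero, ← neg_ne_zero, neg_sub, ← sin_sq, sq_eq_zero_iff.ne]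
    refine (prod_eq_mul_one_sub_of_sum_ite (sum_steeredProb ..) (pow_ne_zero 2 hcos) hcos₁
      (sum_ite_eq_of_sum_smul_pureState_eq (sum_steeredProb ..) hsum)).trans ?_
    simp [steeredProb, sin_sq]
  · refine (prod_eq_one_div_four_of_sum_neg_one_pow (sum_steeredProb ..)
      (sum_neg_one_pow_eq_zero_of_sum_smul_pureState_eq hθ hsum)).trans ?_
    norm_num [steeredProb]

end

theorem sin_two_mul_sq_eq_of_losrConvertible {θ₁ θ₂ : ℝ} (hθ : sin (2 * θ₂) ≠ 0)
    (h : LOSRConvertible (sigmaResource θ₁ 1) (sigmaResource θ₂ 1)) :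
    sin (2 * θ₁) ^ 2 = sin (2 * θ₂) ^ 2 := by
  obtain ⟨Φ, g, f, hΦ⟩ : ∃ (Φ : Op 2 →ₗ[ℂ] Op 2) (g : Fin 2 → Fin 2) (f : Fin 2 → Fin 2 → Fin 2),
      ∀ a x, Φ ((sigmaFamily θ₁ 1).σ a (g x)) =
        ((sigmaFamily θ₁ 1).σ a (g x)).trace • pureState (steeredVec θ₂ (f x a) x) :=
    h.exists_map_eq_trace_smul_pureState (star_steeredVec_dotProduct_self θ₂) fun a x =>
      (congrFun₂ (sigmaFamily_one_σ θ₂) a x).trans (sigmaTheta_eq_smul_pureState θ₂ a x)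
  simp only [sigmaFamily_one_σ, trace_sigmaTheta] at hΦ
  have hg := Finite.injective_iff_bijective.mp (injective_of_map_sigmaTheta hθ hΦ)
  have hsum : ∑ x, ∏ a, steeredProb θ₁ a x = ∑ x, ∏ a, steeredProb θ₂ a x :=
    (hg.sum_comp fun x => ∏ a, steeredProb θ₁ a x).symm.trans <|
      Finset.sum_congr rfl fun x _ => prod_steeredProb_eq_of_map_sigmaTheta hθ hΦ x
  rw [sum_prod_steeredProb, sum_prod_steeredProb] at hsum
  linarith

theorem sin_two_mul_pos {θ : ℝ} (h₀ : 0 < θ) (hθ : θ < π / 2) : 0 < sin (2 * θ) :=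
  sin_pos_of_pos_of_lt_pi (by linarith) (by linarith)

theorem sin_two_mul_sq_injOn : Set.InjOn (fun θ => sin (2 * θ) ^ 2) (Set.Icc 0 (π / 4)) := by
  intro θ₁ h₁ θ₂ h₂ h
  have hmem : ∀ θ ∈ Set.Icc 0 (π / 4), 2 * θ ∈ Set.Icc (-(π / 2)) (π / 2) := fun θ hθ =>
    ⟨by linarith [hθ.1, pi_pos], by linarith [hθ.2]⟩
  have hnonneg : ∀ θ ∈ Set.Icc 0 (π / 4), 0 ≤ sin (2 * θ) := fun θ hθ =>
    sin_nonneg_of_nonneg_of_le_pi (by linarith [hθ.1]) (by linarith [hθ.2, pi_pos])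
  have hsin := (pow_left_inj₀ (hnonneg θ₁ h₁) (hnonneg θ₂ h₂) two_ne_zero).mp h
  exact mul_left_cancel₀ two_ne_zero (injOn_sin (hmem θ₁ h₁) (hmem θ₂ h₂) hsin)

theorem losrPreorder_ne {P : Preorder Resource}
    (hP : P.le (sigmaResource (π / 6) 1) (sigmaResource (π / 4) 1)) : losrPreorder ≠ P := by
  rintro rfl
  have hlt : π / 6 < π / 4 := by linarith [pi_pos]
  have hpos : 0 < π / 6 := by positivity
  have hsin := sin_two_mul_sq_eq_of_losrConvertible
    (sin_two_mul_pos hpos (by linarith [pi_pos])).ne' hP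
  exact hlt.ne' <| sin_two_mul_sq_injOn ⟨(hpos.trans hlt).le, le_rfl⟩ ⟨hpos.le, hlt.le⟩ hsin

end Incomparability

section CompletelyPositive

theorem IsCompletelyPositive.smul {d e : ℕ} {Φ : Op d →ₗ[ℂ] Op e} (hΦ : IsCompletelyPositive Φ)
    {c : ℂ} (hc : 0 ≤ c) : IsCompletelyPositive (c • Φ) :=
  fun k M hM => (hΦ k M hM).smul hc

/-- The map `ρ ↦ tr ρ • τ` which discards the system and prepares `τ` instead. -/
noncomputable def traceReplace (d : ℕ) {e : ℕ} (τ : Op e) : Op d →ₗ[ℂ] Op e :=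
  (traceLinearMap (Fin d) ℂ ℂ).smulRight τ

theorem traceReplace_apply {d e : ℕ} (τ : Op e) (ρ : Op d) :
    traceReplace d τ ρ = ρ.trace • τ := rfl

theorem isCompletelyPositive_traceReplace (d : ℕ) {e : ℕ} {τ : Op e} (hτ : τ.PosSemidef) :
    IsCompletelyPositive (traceReplace d τ) := by
  intro k M hM
  have h : of (fun r s : Fin e × Fin k => traceReplace d τ (of fun i j => M (i, r.2) (j, s.2))
      r.1 s.1) = τ ⊗ₖ ptraceA M := by
    ext r s
    exact mul_comm (_ : ℂ) _
  rw [h]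
  exact hτ.kronecker (posSemidef_ptraceA hM)

end CompletelyPositive

section Branch

variable {nA nX d nA' nX' d' : ℕ}

theorem branch_smul (C : Comb nA nX nA' nX') (c : ℂ) (Φ : Op d →ₗ[ℂ] Op d')
    (σ : Fin nA → Fin nX → Op d) (a' : Fin nA') (x' : Fin nX') :
    branch C (c • Φ) σ a' x' = c • branch C Φ σ a' x' := by
  simp only [branch, LinearMap.smul_apply, Finset.smul_sum, smul_comm c]

theorem branch_ofFun (g : Fin nX' → Fin nX) (f : Fin nA → Fin nX' → Fin nA')
    (Φ : Op d →ₗ[ℂ] Op d') (σ : Fin nA → Fin nX → Op d) (a' : Fin nA') (x' : Fin nX') :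
    branch (Comb.ofFun g f) Φ σ a' x' = ∑ a, if a' = f a x' then Φ (σ a (g x')) else 0 := by
  refine Finset.sum_congr rfl fun a _ => ?_
  rw [Finset.sum_eq_single_of_mem (g x') (Finset.mem_univ _) fun x _ hx => by
    simp [Comb.ofFun, hx]]
  split_ifs with h <;> simp [Comb.ofFun, h]

theorem branch_ofFun_of_injective (g : Fin nX' → Fin nX) {f : Fin nA → Fin nX' → Fin nA'}
    (Φ : Op d →ₗ[ℂ] Op d') (σ : Fin nA → Fin nX → Op d) {x' : Fin nX'}
    (hf : Function.Injective fun a => f a x') (a : Fin nA) :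
    branch (Comb.ofFun g f) Φ σ (f a x') x' = Φ (σ a (g x')) := by
  simp [branch_ofFun, hf.eq_iff]

end Branch

namespace OneWayLOCC

variable {nA nX d nA' nX' d' : ℕ}

/-- The operation which discards the assemblage: Bob prepares one of the states `τ b` with
probability `tr (τ b)`, and Alice outputs `b`. -/
noncomputable def prepare (nA d : ℕ) (g : Fin nX' → Fin nX) (τ : Fin nA' → Op d')
    (hτ : ∀ b, (τ b).PosSemidef) (htr : ∑ b, (τ b).trace = 1) :
    OneWayLOCC nA nX d nA' nX' d' where
  W := Fin nA'
  bob b := traceReplace d (τ b)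
  bob_cp b := isCompletelyPositive_traceReplace d (hτ b)
  bob_tni ρ _ := by
    simp only [traceReplace_apply, trace_smul, smul_eq_mul, ← Finset.mul_sum, htr, mul_one, le_refl]
  alice b := Comb.ofFun g fun _ _ => b

theorem isDeterministic_prepare (nA d : ℕ) (g : Fin nX' → Fin nX) (τ : Fin nA' → Op d')
    (hτ : ∀ b, (τ b).PosSemidef) (htr : ∑ b, (τ b).trace = 1) :
    (prepare nA d g τ hτ htr).IsDeterministic := by
  intro ρ
  change ∑ b, (traceReplace d (τ b) ρ).trace = ρ.trace
  simp only [traceReplace_apply, trace_smul, smul_eq_mul, ← Finset.mul_sum, htr, mul_one]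

theorem prepare_apply (S : Assemblage nA nX d) (g : Fin nX' → Fin nX) (τ : Fin nA' → Op d')
    (hτ : ∀ b, (τ b).PosSemidef) (htr : ∑ b, (τ b).trace = 1) (a' : Fin nA') (x' : Fin nX') :
    (prepare nA d g τ hτ htr).apply S.σ a' x' = τ a' := by
  change ∑ b, branch (Comb.ofFun g fun _ _ => b) (traceReplace d (τ b)) S.σ a' x' = τ a'
  simp only [branch_ofFun, Finset.sum_ite_irrel, Finset.sum_const_zero, Finset.sum_ite_eq,
    Finset.mem_univ, if_true, traceReplace_apply, ← Finset.sum_smul, S.sum_trace, one_smul]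

/-- The convex mixture of operations: with probability `p` Bob applies the instrument of `U`, and
otherwise that of `V`; the disjoint union of outcome sets tells Alice which one it was. -/
noncomputable def mix (p : Set.Icc (0 : ℝ) 1) (U V : OneWayLOCC nA nX d nA' nX' d') :
    OneWayLOCC nA nX d nA' nX' d' where
  W := U.W ⊕ V.W
  bob := Sum.elim (fun u => ((p : ℝ) : ℂ) • U.bob u) fun v => ((1 - p : ℝ) : ℂ) • V.bob v
  bob_cp := by
    rintro (u | v)
    · exact (U.bob_cp u).smul (Complex.zero_le_real.mpr p.2.1)
    · exact (V.bob_cp v).smul (Complex.zero_le_real.mpr (sub_nonneg.mpr p.2.2))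
  bob_tni ρ hρ := by
    simp only [Fintype.sum_sum_type, Sum.elim_inl, Sum.elim_inr, LinearMap.smul_apply, trace_smul,
      smul_eq_mul, ← Finset.mul_sum, Complex.add_re, Complex.re_ofReal_mul]
    exact convex_Iic (𝕜 := ℝ) ρ.trace.re (U.bob_tni ρ hρ) (V.bob_tni ρ hρ) p.2.1
      (sub_nonneg.mpr p.2.2) (add_sub_cancel _ _)
  alice := Sum.elim U.alice V.alice

theorem IsDeterministic.mix (p : Set.Icc (0 : ℝ) 1) {U V : OneWayLOCC nA nX d nA' nX' d'}
    (hU : U.IsDeterministic) (hV : V.IsDeterministic) : (mix p U V).IsDeterministic := by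
  intro ρ
  refine (Fintype.sum_sum_type _).trans ?_
  simp only [OneWayLOCC.mix, Sum.elim_inl, Sum.elim_inr, LinearMap.smul_apply, trace_smul,
    smul_eq_mul, ← Finset.mul_sum, hU ρ, hV ρ, ← add_mul, ← Complex.ofReal_add, add_sub_cancel,
    Complex.ofReal_one, one_mul]

theorem mix_apply (p : Set.Icc (0 : ℝ) 1) (U V : OneWayLOCC nA nX d nA' nX' d')
    (σ : Fin nA → Fin nX → Op d) (a' : Fin nA') (x' : Fin nX') :
    (mix p U V).apply σ a' x' =
      ((p : ℝ) : ℂ) • U.apply σ a' x' + ((1 - p : ℝ) : ℂ) • V.apply σ a' x' := by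
  refine (Fintype.sum_sum_type _).trans ?_
  simp only [mix, Sum.elim_inl, Sum.elim_inr, branch_smul, ← Finset.smul_sum, OneWayLOCC.apply]

end OneWayLOCC

section Conversion

theorem stochasticOp_apply (θ : ℝ) (a x : Fin 2) :
    (stochasticOp θ).apply (sigmaFamily (π / 4) 1).σ a x = (1 / 2 : ℂ) • sigmaTheta θ a x := by
  refine (Finset.sum_singleton ..).trans ?_
  refine (branch_ofFun_of_injective (f := fun a _ => a) id (krausMap (krausM θ 0)) _
    Function.injective_id a).trans ?_
  rw [sigmaFamily_one_σ, id, krausMap_krausM_sigmaTheta_pi_div_four, mul_zero, add_zero, add_zero]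

theorem stochasticOp_converts (θ : ℝ) :
    (stochasticOp θ).Converts (1 / 2) (sigmaFamily (π / 4) 1) (sigmaFamily θ 1) := by
  refine ⟨one_half_pos, fun a x => ?_⟩
  rw [stochasticOp_apply, sigmaFamily_one_σ]
  norm_num

theorem isDeterministic_deterministicOp (θ : ℝ) : (deterministicOp θ).IsDeterministic :=
  fun ρ => (Fin.sum_univ_two _).trans (trace_krausM θ ρ)

theorem branch_deterministicOp (θ : ℝ) (w a x : Fin 2) :
    branch ((deterministicOp θ).alice w) ((deterministicOp θ).bob w) (sigmaFamily (π / 4) 1).σ a x =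
      (1 / 2 : ℂ) • sigmaTheta θ a x := by
  have hinj : Function.Injective fun a : Fin 2 => a + x * w + w :=
    (add_left_injective w).comp (add_left_injective (x * w))
  obtain ⟨b, rfl⟩ := Finite.surjective_of_injective hinj a
  refine (branch_ofFun_of_injective (f := fun a x => a + x * w + w) id (krausMap (krausM θ w)) _
    hinj b).trans ?_
  rw [sigmaFamily_one_σ]
  exact krausMap_krausM_sigmaTheta_pi_div_four θ w b x

theorem deterministicOp_apply (θ : ℝ) (a x : Fin 2) :
    (deterministicOp θ).apply (sigmaFamily (π / 4) 1).σ a x = sigmaTheta θ a x := by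
  refine (Finset.sum_congr rfl fun w _ => branch_deterministicOp θ w a x).trans ?_
  refine (Fin.sum_univ_two _).trans ?_
  rw [← add_smul, add_halves, one_smul]

theorem deterministicOp_converts (θ : ℝ) :
    (deterministicOp θ).Converts 1 (sigmaFamily (π / 4) 1) (sigmaFamily θ 1) := by
  refine ⟨one_pos, fun a x => ?_⟩
  rw [deterministicOp_apply, sigmaFamily_one_σ, Complex.ofReal_one, one_smul]

theorem Det1WConvertible.s1WConvertible {R S : Resource} (h : Det1WConvertible R S) :
    S1WConvertible R S :=
  let ⟨T, _, hT⟩ := h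
  ⟨T, 1, hT⟩

theorem det1WConvertible_sigmaResource (θ : ℝ) (p : Set.Icc (0 : ℝ) 1) :
    Det1WConvertible (sigmaResource (π / 4) 1) (sigmaResource θ p) := by
  have hτ : ((4⁻¹ : ℂ) • (1 : Op 2)).PosSemidef := PosSemidef.one.smul (by positivity)
  have htr : ∑ _ : Fin 2, ((4⁻¹ : ℂ) • (1 : Op 2)).trace = 1 := by
    norm_num [trace_smul]
  refine ⟨(deterministicOp θ).mix p (.prepare 2 2 id (fun _ => 4⁻¹ • 1) (fun _ => hτ) htr), ?_, ?_⟩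
  · exact (isDeterministic_deterministicOp θ).mix p (OneWayLOCC.isDeterministic_prepare _ _ _ _ _ _)
  · refine ⟨one_pos, fun a x => ?_⟩
    rw [Complex.ofReal_one, one_smul]
    refine (OneWayLOCC.mix_apply ..).trans ?_
    exact congrArg₂ (fun A B => ((p : ℝ) : ℂ) • A + ((1 - p : ℝ) : ℂ) • B)
      (deterministicOp_apply θ a x) (OneWayLOCC.prepare_apply ..)

end Conversion

theorem proposition1_general :
    losrPreorder ≠ s1wPreorder ∧
    losrPreorder ≠ det1wPreorder ∧
    (∀ θ : ℝ, (stochasticOp θ).Converts (1 / 2) (sigmaFamily (π / 4) 1) (sigmaFamily θ 1)) ∧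
    (∀ θ : ℝ, (deterministicOp θ).IsDeterministic ∧
      (deterministicOp θ).Converts 1 (sigmaFamily (π / 4) 1) (sigmaFamily θ 1)) ∧
    (∀ (θ : ℝ) (p : Set.Icc (0 : ℝ) 1),
      S1WConvertible (sigmaResource (π / 4) 1) (sigmaResource θ p) ∧
      Det1WConvertible (sigmaResource (π / 4) 1) (sigmaResource θ p)) ∧
    (∀ θ₁ θ₂ : ℝ, sin (2 * θ₂) ≠ 0 →
      LOSRConvertible (sigmaResource θ₁ 1) (sigmaResource θ₂ 1) →
      sin (2 * θ₁) ^ 2 = sin (2 * θ₂) ^ 2) :=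
  ⟨losrPreorder_ne (det1WConvertible_sigmaResource _ _).s1WConvertible,
    losrPreorder_ne (det1WConvertible_sigmaResource _ _),
    stochasticOp_converts,
    fun θ => ⟨isDeterministic_deterministicOp θ, deterministicOp_converts θ⟩,
    fun θ p => ⟨(det1WConvertible_sigmaResource θ p).s1WConvertible,
      det1WConvertible_sigmaResource θ p⟩,
    fun _ _ => sin_two_mul_sq_eq_of_losrConvertible⟩

theorem proposition1 :
    -- The pre-orders under LOSR and under (stochastic, deterministic) 1W-LOCC are different.
    losrPreorder ≠ s1wPreorder ∧
    losrPreorder ≠ det1wPreorder ∧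
    -- The stochastic Kraus map converts with probability one half.
    (∀ θ ∈ Set.Ioc (0 : ℝ) (Real.pi / 4),
      (stochasticOp θ).Converts (1 / 2) (sigmaFamily (Real.pi / 4) 1) (sigmaFamily θ 1)) ∧
    -- The deterministic 1W-LOCC map.
    (∀ θ ∈ Set.Ioc (0 : ℝ) (Real.pi / 4),
      (deterministicOp θ).IsDeterministic ∧
      (deterministicOp θ).Converts 1 (sigmaFamily (Real.pi / 4) 1) (sigmaFamily θ 1)) ∧
    -- The maximally entangled element is above the whole family.
    (∀ θ ∈ Set.Ioc (0 : ℝ) (Real.pi / 4), ∀ p : Set.Icc (0 : ℝ) 1,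
      S1WConvertible (sigmaResource (Real.pi / 4) 1) (sigmaResource θ p) ∧
      Det1WConvertible (sigmaResource (Real.pi / 4) 1) (sigmaResource θ p)) ∧
    -- Under LOSR the elements with `p = 1` are pairwise incomparable.
    (∀ θ₁ ∈ Set.Ioc (0 : ℝ) (Real.pi / 4), ∀ θ₂ ∈ Set.Ioc (0 : ℝ) (Real.pi / 4), θ₁ ≠ θ₂ →
      ¬ LOSRConvertible (sigmaResource θ₁ 1) (sigmaResource θ₂ 1) ∧
      ¬ LOSRConvertible (sigmaResource θ₂ 1) (sigmaResource θ₁ 1)) := by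
  obtain ⟨hs1w, hdet1w, hstoch, hdet, htop, hlosr⟩ := proposition1_general
  have hinc : ∀ θ₁ ∈ Set.Ioc 0 (π / 4), ∀ θ₂ ∈ Set.Ioc 0 (π / 4), θ₁ ≠ θ₂ →
      ¬ LOSRConvertible (sigmaResource θ₁ 1) (sigmaResource θ₂ 1) := fun θ₁ h₁ θ₂ h₂ hne h =>
    hne <| sin_two_mul_sq_injOn (Set.Ioc_subset_Icc_self h₁) (Set.Ioc_subset_Icc_self h₂) <|
      hlosr θ₁ θ₂ (sin_two_mul_pos h₂.1 (by linarith [h₂.2, pi_pos])).ne' h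
  exact ⟨hs1w, hdet1w, fun θ _ => hstoch θ, fun θ _ => hdet θ, fun θ _ => htop θ,
    fun θ₁ h₁ θ₂ h₂ hne => ⟨hinc θ₁ h₁ θ₂ h₂ hne, hinc θ₂ h₂ θ₁ h₁ hne.symm⟩⟩
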